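/- Let $G$ be a finite simple undirected connected graph. Two vertices $x,y$ of $G$ monitor an edge $e$ if $e$ belongs to all shortest paths between $x$ and $y$ in $G$. A set $S\subseteq V(G)$ is a monitoring edge-geodetic set (MEG-set) of $G$ if every edge of $G$ is monitored by some pair $x,y$ of vertices of $S$; $\mathrm{MEG}(G)$ denotes the smallest size of an MEG-set of $G$. The max leaf number $\mathrm{MLN}(G)$ is the maximum number of leaves (vertices of degree $1$) in a spanning tree of $G$. Then $$\mathrm{MEG}(G)\le 10\,\mathrm{MLN}(G).$$ -/

import Mathlib

namespace SimpleGraph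

variable {V : Type*}

/-- Two vertices `x`, `y` monitor the edge `e` of `G` if they are joined by a path in `G` and
`e` belongs to all shortest paths between them. (A walk of length `G.dist x y` is a path.) -/
def Monitors (G : SimpleGraph V) (x y : V) (e : Sym2 V) : Prop :=
  G.Reachable x y ∧ ∀ p : G.Walk x y, p.length = G.dist x y → e ∈ p.edges

/-- Monitoring edge-geodetic sets: every edge of `G` is monitored by a pair of vertices of `S`. -/
def IsMEGSet (G : SimpleGraph V) (S : Finset V) : Prop :=
  ∀ e ∈ G.edgeSet, ∃ x ∈ S, ∃ y ∈ S, G.Monitors x y e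

/-- `MEG(G)`: the size of a smallest monitoring edge-geodetic set of `G`. -/
noncomputable def megNumber (G : SimpleGraph V) : ℕ :=
  sInf {k | ∃ S : Finset V, G.IsMEGSet S ∧ S.card = k}

/-- `T` is a spanning tree of `G` (on the same vertex set as `G`). -/
def IsSpanningTree (G T : SimpleGraph V) : Prop :=
  T ≤ G ∧ T.IsTree

/-- The leaves of a graph: the vertices with exactly one neighbour. -/
def leaves (T : SimpleGraph V) : Set V :=
  {v | (T.neighborSet v).ncard = 1}

/-- `MLN(G)`: the maximum number of leaves of a spanning tree of `G`. -/
noncomputable def maxLeafNumber (G : SimpleGraph V) : ℕ :=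
  sSup {k | ∃ T : SimpleGraph V, G.IsSpanningTree T ∧ T.leaves.ncard = k}

/-- The set of all vertices is a monitoring edge-geodetic set. -/
theorem isMEGSet_univ [Fintype V] (G : SimpleGraph V) : G.IsMEGSet Finset.univ := by
  intro e
  induction e using Sym2.ind with
  | _ a b =>
    intro h
    have hab : G.Adj a b := h
    refine ⟨a, Finset.mem_univ _, b, Finset.mem_univ _, hab.reachable, fun p hp => ?_⟩
    rw [SimpleGraph.dist_eq_one_iff_adj.2 hab] at hp
    cases p with
    | nil => simp at hp
    | cons h' q =>
      cases q with
      | nil => simp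
      | cons _ _ => simp at hp

/-- The minimum defining `megNumber` is attained in a finite graph. -/
theorem exists_isMEGSet_card_eq [Fintype V] (G : SimpleGraph V) :
    ∃ S : Finset V, G.IsMEGSet S ∧ S.card = G.megNumber :=
  Nat.sInf_mem (s := {k | ∃ S : Finset V, G.IsMEGSet S ∧ S.card = k})
    ⟨_, Finset.univ, G.isMEGSet_univ, rfl⟩

theorem bddAbove_leaves_ncard [Fintype V] (G : SimpleGraph V) :
    BddAbove {k | ∃ T : SimpleGraph V, G.IsSpanningTree T ∧ T.leaves.ncard = k} := by
  refine ⟨Nat.card V, ?_⟩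
  rintro _ ⟨T, -, rfl⟩
  exact Set.ncard_le_card _

/-- The maximum defining `maxLeafNumber` is attained in a finite connected graph. -/
theorem exists_isSpanningTree_ncard_leaves_eq [Fintype V] {G : SimpleGraph V}
    (hG : G.Connected) :
    ∃ T : SimpleGraph V, G.IsSpanningTree T ∧ T.leaves.ncard = G.maxLeafNumber := by
  obtain ⟨T, hT, hT'⟩ := hG.exists_isTree_le
  exact Nat.sSup_mem
    (s := {k | ∃ T : SimpleGraph V, G.IsSpanningTree T ∧ T.leaves.ncard = k})
    ⟨_, T, ⟨hT, hT'⟩, rfl⟩ G.bddAbove_leaves_ncard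

end SimpleGraph

/-!
Let `T` be a spanning tree of `G` with the maximum number `k` of leaves. Call a vertex of tree
degree at least three a branch vertex; summing `deg v - 2` over the tree shows that there are
fewer than `k` of them (`IsTree.card_branch_le_card_leaves`). The vertices of tree degree two form
the interiors of threads, paths of `T` between vertices of other degrees. Rooting `T` at a leaf,
every thread has a lower end `v`, which is a leaf or a branch vertex, and consists of the
ancestors of `v` up to the first one whose degree is not two.

Maximality of `T` restricts the edges outside the tree: if `x` has tree degree two and `xy` is
such an edge, exchanging a suitable edge of the tree path from `x` to `y` for `xy` would create
more leaves than it destroys, unless `x` is within distance two of a branch vertex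
(`IsMaxLeafTree.exists_branch_near`). So only the first two and the last two inner vertices of a
thread can have edges outside the tree, and the first two only if the thread does not start at a
leaf (`IsMaxLeafTree.position_of_adj`).

For each thread take its lower end, these exceptional inner vertices, and the middle of the part
between them. For a leaf this makes `1 + 2 + 1` vertices and for a branch vertex `1 + 4 + 1`,
hence at most `4 * k + 6 * k` in total. All edges outside the tree have both ends in this set. The
remaining part of a long thread is an induced path whose inner vertices have degree two in `G`,
and its ends are not adjacent, again by an exchange argument. A detour around such a path of
length `L` therefore costs at least two steps outside it, so each half of the path is the unique
shortest path between its ends (`exists_monitors_of_thread`).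
-/

namespace SimpleGraph

/-! ### Lower bounds on distances from potentials -/

/-- If a potential `f` grows by at most one along every edge other than `e`, then a walk shorter
than the growth of `f` between its ends uses `e`. -/
theorem Walk.mem_edges_of_potential {V : Type*} {G : SimpleGraph V} {e : Sym2 V} (f : V → ℤ)
    (hf : ∀ u v, G.Adj u v → s(u, v) ≠ e → f v ≤ f u + 1) {x y : V} (p : G.Walk x y)
    (hp : (p.length : ℤ) < f y - f x) : e ∈ p.edges := by
  induction p with
  | nil => simp at hp
  | @cons a b c h q ih =>
    rw [Walk.edges_cons, List.mem_cons]
    by_cases he : s(a, b) = e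
    · exact Or.inl he.symm
    · refine Or.inr (ih ?_)
      have := hf a b h he
      rw [Walk.length_cons] at hp
      push_cast at hp
      linarith

/-- A thread of length `L` in `G` whose ends are not adjacent: its edges up to the `m`-th vertex are
monitored from `w 0` and `w m`, as long as `m` is at most about half of `L`. Deleting an edge
`e` of this part leaves only the detour around the other end of the thread, which is longer. -/
theorem monitors_of_thread {V : Type*} {G : SimpleGraph V} {w : ℕ → V} {L m i : ℕ}
    (hadj : ∀ j < L, G.Adj (w j) (w (j + 1)))
    (hinj : ∀ j ≤ L, ∀ l ≤ L, w j = w l → j = l)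
    (hint : ∀ j, 0 < j → j < L → ∀ v, G.Adj (w j) v → v = w (j - 1) ∨ v = w (j + 1))
    (hends : ¬ G.Adj (w 0) (w L)) (hm : m ≤ L) (hm2 : 2 * m < L + 2) (hi : i < m) :
    G.Monitors (w 0) (w m) s(w i, w (i + 1)) := by
  classical
  have hwalk : ∀ j ≤ L, ∃ p : G.Walk (w 0) (w j), p.length = j := by
    intro j
    induction j with
    | zero => exact fun _ => ⟨.nil, rfl⟩
    | succ j ih =>
      intro hj
      obtain ⟨p, hp⟩ := ih (by omega)
      exact ⟨p.concat (hadj j (by omega)), by simp [hp]⟩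
  obtain ⟨q, hq⟩ := hwalk m hm
  refine ⟨⟨q⟩, fun p hp => ?_⟩
  have hle : p.length ≤ m := by rw [hp]; exact (dist_le q).trans hq.le
  -- The potential is the distance from `w i` in the graph without `e`, up to a shift and to
  -- replacing distances outside the thread by lower bounds.
  let g : ℕ → ℤ := fun j => if j ≤ i then -j else 2 + L - j
  let f : V → ℤ := fun v => if h : ∃ j ≤ L, w j = v then g h.choose else 1
  have hfw : ∀ j ≤ L, f (w j) = g j := by
    intro j hj
    have h : ∃ l ≤ L, w l = w j := ⟨j, hj, rfl⟩
    have h1 := h.choose_spec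
    have : f (w j) = g h.choose := dif_pos h
    rw [this, hinj _ h1.1 _ hj h1.2]
  have hfo : ∀ v, (¬ ∃ j ≤ L, w j = v) → f v = 1 := fun v h => dif_neg h
  have hnb : ∀ j ≤ L, ∀ l ≤ L, G.Adj (w j) (w l) → l = j + 1 ∨ j = l + 1 := by
    intro j hj l hl h
    by_cases h1 : 0 < j ∧ j < L
    · rcases hint j h1.1 h1.2 _ h with h2 | h2
      · have := hinj _ hl _ (by omega) h2; omega
      · have := hinj _ hl _ (by omega) h2; omega
    by_cases h3 : 0 < l ∧ l < L
    · rcases hint l h3.1 h3.2 _ h.symm with h2 | h2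
      · have := hinj _ hj _ (by omega) h2; omega
      · have := hinj _ hj _ (by omega) h2; omega
    have h4 : j ≠ l := by rintro rfl; exact h.ne rfl
    have h5 : (j = 0 ∧ l = L) ∨ (j = L ∧ l = 0) := by omega
    rcases h5 with ⟨rfl, rfl⟩ | ⟨rfl, rfl⟩
    · exact absurd h hends
    · exact absurd h.symm hends
  have hout : ∀ j ≤ L, ∀ v, (¬ ∃ l ≤ L, w l = v) → G.Adj (w j) v →
      j = 0 ∨ j = L := by
    intro j hj v hv h
    by_contra hc
    rcases hint j (by omega) (by omega) v h with h2 | h2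
    · exact hv ⟨_, by omega, h2.symm⟩
    · exact hv ⟨_, by omega, h2.symm⟩
  refine p.mem_edges_of_potential f ?_ ?_
  · intro u v huv hne
    by_cases hu : ∃ j ≤ L, w j = u
    · obtain ⟨j, hj, rfl⟩ := hu
      by_cases hv : ∃ l ≤ L, w l = v
      · obtain ⟨l, hl, rfl⟩ := hv
        rw [hfw j hj, hfw l hl]
        simp only [g]
        rcases hnb j hj l hl huv with rfl | rfl
        · have : j ≠ i := by rintro rfl; exact hne rfl
          split_ifs <;> omega
        · have : l ≠ i := by rintro rfl; exact hne Sym2.eq_swap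
          split_ifs <;> omega
      · rw [hfw j hj, hfo v hv]
        simp only [g]
        rcases hout j hj v hv huv with rfl | rfl
        · split_ifs <;> omega
        · split_ifs <;> omega
    · rw [hfo u hu]
      by_cases hv : ∃ l ≤ L, w l = v
      · obtain ⟨l, hl, rfl⟩ := hv
        rw [hfw l hl]
        simp only [g]
        rcases hout l hl u hu huv.symm with rfl | rfl
        · split_ifs <;> omega
        · split_ifs <;> omega
      · rw [hfo v hv]; omega
  · rw [hfw m hm, hfw 0 (by omega)]
    simp only [g]
    split_ifs <;> omega

/-- Three vertices monitor a whole thread with non-adjacent ends: its two ends and its middle. -/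
theorem exists_monitors_of_thread {V : Type*} {G : SimpleGraph V} {w : ℕ → V} {L i : ℕ}
    (hadj : ∀ j < L, G.Adj (w j) (w (j + 1)))
    (hinj : ∀ j ≤ L, ∀ l ≤ L, w j = w l → j = l)
    (hint : ∀ j, 0 < j → j < L → ∀ v, G.Adj (w j) v → v = w (j - 1) ∨ v = w (j + 1))
    (hends : ¬ G.Adj (w 0) (w L)) (hi : i < L) :
    G.Monitors (w 0) (w (L / 2)) s(w i, w (i + 1)) ∨
      G.Monitors (w L) (w (L / 2)) s(w i, w (i + 1)) := by
  by_cases h : i < L / 2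
  · exact Or.inl (monitors_of_thread hadj hinj hint hends (by omega) (by omega) h)
  · right
    have := monitors_of_thread (G := G) (w := fun j => w (L - j)) (L := L) (m := L - L / 2)
      (i := L - 1 - i) ?_ ?_ ?_ ?_ (by omega) (by omega) (by omega)
    · rw [show L - (L - 1 - i) = i + 1 by omega, show L - (L - 1 - i + 1) = i by omega,
        show L - (L - L / 2) = L / 2 by omega, Sym2.eq_swap] at this
      simpa using this
    · intro j hj
      have := (hadj (L - (j + 1)) (by omega)).symm
      rwa [show L - (j + 1) + 1 = L - j by omega] at this
    · intro j hj l hl h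
      have := hinj _ (by omega) _ (by omega) h
      omega
    · intro j h0 hj v hv
      rw [show L - (j - 1) = L - j + 1 by omega, show L - (j + 1) = L - j - 1 by omega]
      exact (hint (L - j) (by omega) (by omega) v hv).symm
    · simpa using fun h => hends (h : G.Adj _ _).symm

/-! ### Edge exchanges in spanning trees -/

/-- The graph obtained from `T` by replacing the edge `zz'` by the edge `xy`. -/
def exchange {V : Type*} (T : SimpleGraph V) (z z' x y : V) : SimpleGraph V :=
  T.deleteEdges {s(z, z')} ⊔ edge x y

theorem exchange_adj {V : Type*} {T : SimpleGraph V} {z z' x y : V} (hxy : x ≠ y) (a b : V) :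
    (T.exchange z z' x y).Adj a b ↔
      (T.Adj a b ∧ s(a, b) ≠ s(z, z')) ∨ s(a, b) = s(x, y) := by
  simp only [exchange, sup_adj, deleteEdges_adj, edge_adj, Set.mem_singleton_iff, ne_eq,
    Sym2.eq_iff]
  grind

/-- Deleting `zz'` leaves two components, and `xy` joins them again if its ends lie on different
sides. -/
theorem isSpanningTree_exchange {V : Type*} {G T : SimpleGraph V} (hT : G.IsSpanningTree T)
    {z z' x y : V} (hz : T.Adj z z') (hxy : G.Adj x y)
    (hx : (T.deleteEdges {s(z, z')}).Reachable z x)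
    (hy : (T.deleteEdges {s(z, z')}).Reachable z' y) :
    G.IsSpanningTree (T.exchange z z' x y) := by
  obtain ⟨hle, hc, ha⟩ := hT
  have hadj := fun a b => exchange_adj (T := T) (z := z) (z' := z') hxy.ne a b
  refine ⟨fun a b h => ?_, ?_, ?_⟩
  · rcases (hadj a b).1 h with h | h
    · exact hle h.1
    · rw [← mem_edgeSet, h]; exact hxy
  · have hmono : T.deleteEdges {s(z, z')} ≤ T.exchange z z' x y := le_sup_left
    have hzz : (T.exchange z z' x y).Reachable z z' :=
      ((hx.mono hmono).trans (Adj.reachable ((hadj x y).2 (Or.inr rfl)))).trans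
        (hy.mono hmono).symm
    have hstep : ∀ a b, T.Adj a b → (T.exchange z z' x y).Reachable a b := by
      intro a b h
      by_cases he : s(a, b) = s(z, z')
      · rcases Sym2.eq_iff.1 he with ⟨rfl, rfl⟩ | ⟨rfl, rfl⟩
        · exact hzz
        · exact hzz.symm
      · exact Adj.reachable ((hadj a b).2 (Or.inl ⟨h, he⟩))
    have : Nonempty V := hc.nonempty
    refine Connected.mk fun a b => ?_
    obtain ⟨p⟩ := hc.preconnected a b
    induction p with
    | nil => exact .refl _
    | cons h _ ih => exact (hstep _ _ h).trans ih
  · refine (ha.anti (deleteEdges_le _)).sup_edge_of_not_reachable fun h => ?_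
    have := (isAcyclic_iff_forall_adj_isBridge.1 ha) hz
    exact (isBridge_iff.1 this) ((hx.trans h).trans hy.symm)

theorem mem_leaves_iff {V : Type*} {T : SimpleGraph V} {v : V} :
    v ∈ T.leaves ↔ ∃ u, ∀ a, T.Adj v a ↔ a = u := by
  simp only [leaves, Set.mem_ofPred_eq, Set.ncard_eq_one, Set.ext_iff, mem_neighborSet,
    Set.mem_singleton_iff]

theorem ncard_neighborSet_eq_degree {V : Type*} (T : SimpleGraph V) (v : V)
    [Fintype (T.neighborSet v)] : (T.neighborSet v).ncard = T.degree v := by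
  rw [← Nat.card_coe_set_eq, Nat.card_eq_fintype_card, card_neighborSet_eq_degree]

theorem ncard_neighborSet_eq_two {V : Type*} {T : SimpleGraph V} {v : V} :
    (T.neighborSet v).ncard = 2 ↔ ∃ u u', u ≠ u' ∧ ∀ a, T.Adj v a ↔ a = u ∨ a = u' := by
  simp only [Set.ncard_eq_two, Set.ext_iff, mem_neighborSet,
    Set.mem_singleton_iff, Set.mem_insert_iff]

theorem three_le_ncard_neighborSet {V : Type*} [Finite V] {T : SimpleGraph V} {v u u' : V}
    (h : T.Adj v u) (h' : T.Adj v u') (hne : u ≠ u') (h2 : (T.neighborSet v).ncard ≠ 2) :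
    3 ≤ (T.neighborSet v).ncard := by
  have : ({u, u'} : Set V).ncard ≤ (T.neighborSet v).ncard :=
    Set.ncard_le_ncard (by rintro a (rfl | rfl) <;> assumption)
  rw [Set.ncard_pair hne] at this
  omega

theorem mem_leaves_exchange {V : Type*} {T : SimpleGraph V} {z z' x y v : V} (hxy : x ≠ y)
    (hv : v ∈ T.leaves) (hx : v ≠ x) (hy : v ≠ y) (hz : v ≠ z) (hz' : v ≠ z') :
    v ∈ (T.exchange z z' x y).leaves := by
  rw [mem_leaves_iff] at hv ⊢
  obtain ⟨u, hu⟩ := hv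
  refine ⟨u, fun a => ?_⟩
  rw [exchange_adj hxy, ← hu, ne_eq, Sym2.eq_iff, Sym2.eq_iff]
  tauto

theorem left_mem_leaves_exchange {V : Type*} {T : SimpleGraph V} {z z' x y : V} (hxy : x ≠ y)
    (hzz : T.Adj z z') (h2 : (T.neighborSet z).ncard = 2) (hx : z ≠ x) (hy : z ≠ y) :
    z ∈ (T.exchange z z' x y).leaves := by
  obtain ⟨u, u', hne, hu⟩ := ncard_neighborSet_eq_two.1 h2
  have hz' := (hu z').1 hzz
  rw [mem_leaves_iff]
  rcases hz' with rfl | rfl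
  · refine ⟨u', fun a => ?_⟩
    rw [exchange_adj hxy, hu, ne_eq, Sym2.eq_iff, Sym2.eq_iff]
    grind
  · refine ⟨u, fun a => ?_⟩
    rw [exchange_adj hxy, hu, ne_eq, Sym2.eq_iff, Sym2.eq_iff]
    grind

theorem exchange_swap {V : Type*} (T : SimpleGraph V) (z z' x y : V) :
    T.exchange z z' x y = T.exchange z' z x y := by
  rw [exchange, exchange, Sym2.eq_swap]

theorem right_mem_leaves_exchange {V : Type*} {T : SimpleGraph V} {z z' x y : V} (hxy : x ≠ y)
    (hzz : T.Adj z z') (h2 : (T.neighborSet z').ncard = 2) (hx : z' ≠ x) (hy : z' ≠ y) :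
    z' ∈ (T.exchange z z' x y).leaves := by
  rw [exchange_swap]
  exact left_mem_leaves_exchange hxy hzz.symm h2 hx hy

/-- A path does not return to its start, so beyond its first edge it avoids that edge. -/
theorem Walk.IsPath.reachable_deleteEdges {V : Type*} {T : SimpleGraph V} {x u y : V}
    {h : T.Adj x u} {q : T.Walk u y} (hp : (Walk.cons h q).IsPath) :
    (T.deleteEdges {s(x, u)}).Reachable u y := by
  refine ⟨q.toDeleteEdges _ fun e he hc => ?_⟩
  rw [Set.mem_singleton_iff] at hc
  subst hc
  exact ((Walk.cons_isPath_iff _ _).1 hp).2 (q.fst_mem_support_of_mem_edges he)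

/-! ### Spanning trees with the maximum number of leaves -/

/-- A spanning tree of `G` with as many leaves as possible. -/
def IsMaxLeafTree {V : Type*} (G T : SimpleGraph V) : Prop :=
  G.IsSpanningTree T ∧ ∀ T', G.IsSpanningTree T' → T'.leaves.ncard ≤ T.leaves.ncard

/-- Otherwise the last tree edge at the leaf `y` could be exchanged for `xy`: `y` stays a leaf and
its former neighbour becomes one. -/
theorem IsMaxLeafTree.ncard_ne_two_of_adj_leaf {V : Type*} [Finite V] {G T : SimpleGraph V}
    (hT : G.IsMaxLeafTree T) {x y p : V} (hxy : G.Adj x y) (hn : ¬ T.Adj x y)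
    (hy : y ∈ T.leaves) (hx : x ∉ T.leaves) (hp : T.Adj y p) :
    (T.neighborSet p).ncard ≠ 2 := by
  intro h2
  obtain ⟨c, hc⟩ := mem_leaves_iff.1 hy
  obtain rfl := (hc p).1 hp
  have hpx : p ≠ x := by rintro rfl; exact hn hp.symm
  have hpl : p ∉ T.leaves := fun h => by
    have : (T.neighborSet p).ncard = 1 := h
    omega
  obtain ⟨q, hq⟩ := (hT.1.2.existsUnique_path y x).exists
  cases q with
  | nil => exact hxy.ne rfl
  | @cons _ b _ h q =>
    obtain rfl := (hc b).1 h
    have hsp := isSpanningTree_exchange hT.1 h hxy.symm (.refl _) hq.reachable_deleteEdges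
    have hle := hT.2 _ hsp
    have hsub : insert b T.leaves ⊆ (T.exchange y b y x).leaves := by
      rintro v (rfl | hv)
      · exact right_mem_leaves_exchange hxy.ne' h h2 h.ne' hpx
      · by_cases hvy : v = y
        · subst hvy
          rw [mem_leaves_iff]
          refine ⟨x, fun a => ?_⟩
          rw [exchange_adj hxy.ne', hc, ne_eq, Sym2.eq_iff, Sym2.eq_iff]
          grind
        · exact mem_leaves_exchange hxy.ne' hv hvy (by rintro rfl; exact hx hv) hvy
            (by rintro rfl; exact hpl hv)
    have := Set.ncard_le_ncard hsub
    rw [Set.ncard_insert_of_notMem hpl] at this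
    omega

/-- Otherwise the first edge `xu` of the tree path from `x` to `y` could be exchanged for `xy`,
which makes `u` a leaf and destroys no leaf. -/
theorem IsMaxLeafTree.exists_three_le_of_adj {V : Type*} [Finite V] {G T : SimpleGraph V}
    (hT : G.IsMaxLeafTree T) {x y : V} (hxy : G.Adj x y) (hn : ¬ T.Adj x y)
    (hy : y ∉ T.leaves) (hx : x ∉ T.leaves) :
    ∃ u, T.Adj x u ∧ 3 ≤ (T.neighborSet u).ncard := by
  obtain ⟨q, hq⟩ := (hT.1.2.existsUnique_path x y).exists
  cases q with
  | nil => exact (hxy.ne rfl).elim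
  | @cons _ u _ h q =>
    have huy : u ≠ y := by rintro rfl; exact hn h
    refine ⟨u, h, ?_⟩
    by_cases h2 : (T.neighborSet u).ncard = 2
    · exfalso
      have hul : u ∉ T.leaves := fun h => by
        have : (T.neighborSet u).ncard = 1 := h
        omega
      have hsp := isSpanningTree_exchange hT.1 h hxy (.refl _) hq.reachable_deleteEdges
      have hle := hT.2 _ hsp
      have hsub : insert u T.leaves ⊆ (T.exchange x u x y).leaves := by
        rintro v (rfl | hv)
        · exact right_mem_leaves_exchange hxy.ne h h2 h.ne' huy
        · exact mem_leaves_exchange hxy.ne hv (by rintro rfl; exact hx hv)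
            (by rintro rfl; exact hy hv) (by rintro rfl; exact hx hv)
            (by rintro rfl; exact hul hv)
      have := Set.ncard_le_ncard hsub
      rw [Set.ncard_insert_of_notMem hul] at this
      omega
    · cases q with
      | nil => exact (huy rfl).elim
      | @cons _ u' _ h' q =>
        refine three_le_ncard_neighborSet h.symm h' ?_ h2
        rintro rfl
        simp at hq

/-- A vertex of tree degree two with an edge outside the tree is within distance two of a branch
vertex: if `x, u, u'` starts the tree path from `x` to `y` and `u`, `u'` both have tree degree two,
then exchanging `uu'` for `xy` creates two leaves and destroys at most one. -/
theorem IsMaxLeafTree.exists_branch_near {V : Type*} [Finite V] {G T : SimpleGraph V}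
    (hT : G.IsMaxLeafTree T) {x y : V} (hxy : G.Adj x y) (hn : ¬ T.Adj x y)
    (hx : x ∉ T.leaves) :
    ∃ u, T.Adj x u ∧ (3 ≤ (T.neighborSet u).ncard ∨
      ∃ u', T.Adj u u' ∧ u' ≠ x ∧ 3 ≤ (T.neighborSet u').ncard) := by
  by_cases hy : y ∉ T.leaves
  · obtain ⟨u, h, h3⟩ := hT.exists_three_le_of_adj hxy hn hy hx
    exact ⟨u, h, Or.inl h3⟩
  rw [not_not] at hy
  obtain ⟨q, hq⟩ := (hT.1.2.existsUnique_path x y).exists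
  cases q with
  | nil => exact (hxy.ne rfl).elim
  | @cons _ u _ h q =>
    have huy : u ≠ y := by rintro rfl; exact hn h
    refine ⟨u, h, ?_⟩
    cases q with
    | nil => exact (huy rfl).elim
    | @cons _ u' _ h' q =>
      have hu'x : u' ≠ x := by rintro rfl; simp at hq
      by_cases h2 : (T.neighborSet u).ncard = 2
      swap
      · exact Or.inl (three_le_ncard_neighborSet h.symm h' hu'x.symm h2)
      refine Or.inr ⟨u', h', hu'x, ?_⟩
      have hu'y : u' ≠ y := by
        rintro rfl
        exact hT.ncard_ne_two_of_adj_leaf hxy hn hy hx h'.symm h2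
      by_cases h2' : (T.neighborSet u').ncard = 2
      · exfalso
        have hul : u ∉ T.leaves := fun h => by
          have : (T.neighborSet u).ncard = 1 := h
          omega
        have hul' : u' ∉ T.leaves := fun h => by
          have : (T.neighborSet u').ncard = 1 := h
          omega
        have hxu : (T.deleteEdges {s(u, u')}).Reachable u x := by
          refine Adj.reachable ?_
          rw [deleteEdges_adj, Set.mem_singleton_iff, Sym2.eq_iff]
          refine ⟨h.symm, ?_⟩
          rintro (⟨-, rfl⟩ | ⟨rfl, -⟩)
          · exact hu'x rfl
          · exact h'.ne rfl
        have hsp := isSpanningTree_exchange hT.1 h' hxy hxu hq.of_cons.reachable_deleteEdges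
        have hle := hT.2 _ hsp
        have hsub : insert u (insert u' (T.leaves \ {y})) ⊆ (T.exchange u u' x y).leaves := by
          rintro v (rfl | rfl | ⟨hv, hvy⟩)
          · exact left_mem_leaves_exchange hxy.ne h' h2 h.ne' huy
          · exact right_mem_leaves_exchange hxy.ne h' h2' hu'x hu'y
          · exact mem_leaves_exchange hxy.ne hv (by rintro rfl; exact hx hv) hvy
              (by rintro rfl; exact hul hv) (by rintro rfl; exact hul' hv)
        have h3 := Set.ncard_le_ncard hsub
        rw [Set.ncard_insert_of_notMem (by simp [hul, h'.ne]),
          Set.ncard_insert_of_notMem (by simp [hul'])] at h3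
        have h4 := Set.ncard_sdiff_singleton_add_one hy
        omega
      · cases q with
        | nil => exact (hu'y rfl).elim
        | @cons _ u'' _ h'' q =>
          refine three_le_ncard_neighborSet h'.symm h'' ?_ h2'
          rintro rfl
          simp at hq

/-! ### Threads of a rooted tree -/

open Classical in
/-- The parent of `v` in the tree `T` rooted at `r`: its neighbour closer to `r`. The root is its
own parent. -/
noncomputable def treeParent {V : Type*} (T : SimpleGraph V) (r v : V) : V :=
  if h : ∃ u, T.Adj v u ∧ T.dist v r = T.dist u r + 1 then h.choose else v

theorem treeParent_self {V : Type*} (T : SimpleGraph V) (r : V) : T.treeParent r r = r := by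
  refine dif_neg ?_
  rintro ⟨u, -, h⟩
  simp at h

theorem Connected.treeParent_spec {V : Type*} {T : SimpleGraph V} (hT : T.Connected) {r v : V}
    (hv : v ≠ r) :
    T.Adj v (T.treeParent r v) ∧ T.dist v r = T.dist (T.treeParent r v) r + 1 := by
  have h : ∃ u, T.Adj v u ∧ T.dist v r = T.dist u r + 1 := by
    obtain ⟨p, hp⟩ := hT.exists_walk_length_eq_dist v r
    cases p with
    | nil => exact (hv rfl).elim
    | @cons _ u _ h q =>
      refine ⟨u, h, le_antisymm ?_ ?_⟩
      · have := hT.dist_triangle (u := v) (v := u) (w := r)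
        rw [dist_eq_one_iff_adj.2 h] at this
        omega
      · have := dist_le q
        rw [Walk.length_cons] at hp
        omega
  rw [treeParent, dif_pos h]
  exact h.choose_spec

theorem IsTree.treeParent_eq {V : Type*} {T : SimpleGraph V} (hT : T.IsTree) {r v u : V}
    (h : T.Adj v u) (hd : T.dist v r = T.dist u r + 1) : T.treeParent r v = u := by
  have hv : v ≠ r := by rintro rfl; simp at hd
  obtain ⟨h', hd'⟩ := hT.connected.treeParent_spec hv
  obtain ⟨p, hp⟩ := hT.connected.exists_walk_length_eq_dist u r
  obtain ⟨p', hp'⟩ := hT.connected.exists_walk_length_eq_dist (T.treeParent r v) r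
  have h1 : (Walk.cons h p).IsPath := Walk.isPath_of_length_eq_dist _ (by simp [hp, hd])
  have h2 : (Walk.cons h' p').IsPath := Walk.isPath_of_length_eq_dist _ (by simp [hp', hd'])
  have := (hT.existsUnique_path v r).unique h1 h2
  have := congrArg Walk.snd this
  simpa using this.symm

/-- Each edge of a rooted tree joins a vertex other than the root to its parent. -/
theorem IsTree.treeParent_eq_or {V : Type*} {T : SimpleGraph V} (hT : T.IsTree) (r : V) {v u : V}
    (h : T.Adj v u) : (v ≠ r ∧ T.treeParent r v = u) ∨ (u ≠ r ∧ T.treeParent r u = v) := by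
  rcases hT.dist_eq_dist_add_one_of_adj r h with hd | hd
  · rw [dist_comm, T.dist_comm (u := r)] at hd
    exact Or.inl ⟨by rintro rfl; simp at hd, hT.treeParent_eq h hd⟩
  · rw [dist_comm, T.dist_comm (u := r)] at hd
    exact Or.inr ⟨by rintro rfl; simp at hd, hT.treeParent_eq h.symm hd⟩

/-- The `i`-th ancestor of `k`. -/
noncomputable def ancestor {V : Type*} (T : SimpleGraph V) (r k : V) (i : ℕ) : V :=
  (T.treeParent r)^[i] k

theorem ancestor_zero {V : Type*} (T : SimpleGraph V) (r k : V) : T.ancestor r k 0 = k := rfl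

theorem ancestor_succ {V : Type*} (T : SimpleGraph V) (r k : V) (i : ℕ) :
    T.ancestor r k (i + 1) = T.treeParent r (T.ancestor r k i) :=
  Function.iterate_succ_apply' _ _ _

/-- The length of the thread starting at `k`: the distance to the first proper ancestor whose degree
is not two. -/
noncomputable def threadLength {V : Type*} (T : SimpleGraph V) (r k : V) : ℕ :=
  sInf {n | 1 ≤ n ∧ (T.neighborSet (T.ancestor r k n)).ncard ≠ 2}

section Thread

variable {V : Type*} {T : SimpleGraph V} {r k : V}

theorem Connected.ancestor_dist (hT : T.Connected) :
    ∀ n, ∀ v, T.dist v r = n → T.ancestor r v n = r := by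
  intro n
  induction n with
  | zero => exact fun v hv => hT.dist_eq_zero_iff.1 hv
  | succ n ih =>
    intro v hv
    have hne : v ≠ r := by rintro rfl; simp at hv
    have := (hT.treeParent_spec hne).2
    exact ih (T.treeParent r v) (by omega)

theorem Connected.threadLength_spec (hT : T.Connected) (hr : (T.neighborSet r).ncard ≠ 2) (k : V) :
    1 ≤ T.threadLength r k ∧
      (T.neighborSet (T.ancestor r k (T.threadLength r k))).ncard ≠ 2 := by
  refine Nat.sInf_mem (s := {n | 1 ≤ n ∧ (T.neighborSet (T.ancestor r k n)).ncard ≠ 2})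
    ⟨T.dist k r + 1, by omega, ?_⟩
  rwa [ancestor_succ, hT.ancestor_dist _ k rfl, treeParent_self]

theorem ncard_neighborSet_ancestor {i : ℕ} (h0 : 0 < i) (hi : i < T.threadLength r k) :
    (T.neighborSet (T.ancestor r k i)).ncard = 2 := by
  by_contra h
  exact Nat.notMem_of_lt_sInf hi ⟨h0, h⟩

theorem ancestor_ne_root (hr : (T.neighborSet r).ncard ≠ 2) (hk : k ≠ r) {i : ℕ}
    (hi : i < T.threadLength r k) : T.ancestor r k i ≠ r := by
  rcases Nat.eq_zero_or_pos i with rfl | h0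
  · exact hk
  · intro h
    exact hr (h ▸ ncard_neighborSet_ancestor h0 hi)

theorem Connected.adj_ancestor_succ (hT : T.Connected) (hr : (T.neighborSet r).ncard ≠ 2)
    (hk : k ≠ r) {i : ℕ} (hi : i < T.threadLength r k) :
    T.Adj (T.ancestor r k i) (T.ancestor r k (i + 1)) := by
  rw [ancestor_succ]
  exact (hT.treeParent_spec (ancestor_ne_root hr hk hi)).1

theorem Connected.dist_ancestor (hT : T.Connected) (hr : (T.neighborSet r).ncard ≠ 2)
    (hk : k ≠ r) {i : ℕ} (hi : i ≤ T.threadLength r k) :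
    T.dist (T.ancestor r k i) r + i = T.dist k r := by
  induction i with
  | zero => rfl
  | succ i ih =>
    have := (hT.treeParent_spec (ancestor_ne_root hr hk hi)).2
    rw [ancestor_succ]
    have := ih (by omega)
    omega

theorem Connected.ancestor_inj (hT : T.Connected) (hr : (T.neighborSet r).ncard ≠ 2)
    (hk : k ≠ r) {i j : ℕ} (hi : i ≤ T.threadLength r k) (hj : j ≤ T.threadLength r k)
    (h : T.ancestor r k i = T.ancestor r k j) : i = j := by
  have h1 := hT.dist_ancestor hr hk hi
  have h2 := hT.dist_ancestor hr hk hj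
  rw [h] at h1
  omega

theorem Connected.adj_ancestor_iff (hT : T.Connected) (hr : (T.neighborSet r).ncard ≠ 2)
    (hk : k ≠ r) {i : ℕ} (h0 : 0 < i) (hi : i < T.threadLength r k) {v : V}
    (hv : T.Adj (T.ancestor r k i) v) :
    v = T.ancestor r k (i - 1) ∨ v = T.ancestor r k (i + 1) := by
  have h1 := hT.adj_ancestor_succ hr hk hi
  have h2 := hT.adj_ancestor_succ hr hk (i := i - 1) (by omega)
  rw [show i - 1 + 1 = i by omega] at h2
  have hne : T.ancestor r k (i - 1) ≠ T.ancestor r k (i + 1) := fun h => by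
    have := hT.ancestor_inj hr hk (by omega) (by omega) h
    omega
  obtain ⟨a, b, -, hab⟩ := ncard_neighborSet_eq_two.1 (ncard_neighborSet_ancestor h0 hi)
  have := (hab _).1 h1
  have := (hab _).1 h2.symm
  have := (hab _).1 hv
  grind

/-- Every vertex other than the root lies on a thread: descend until the degree is not two. -/
theorem IsTree.exists_thread [Finite V] (hT : T.IsTree) (hr : (T.neighborSet r).ncard ≠ 2)
    {v : V} (hv : v ≠ r) :
    ∃ k, (T.neighborSet k).ncard ≠ 2 ∧ k ≠ r ∧ ∃ i < T.threadLength r k, T.ancestor r k i = v := by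
  obtain ⟨M, hM⟩ := (Set.finite_range fun v => T.dist v r).bddAbove
  replace hM : ∀ v, T.dist v r ≤ M := fun v => hM ⟨v, rfl⟩
  induction hn : M - T.dist v r using Nat.strong_induction_on generalizing v with
  | _ n ih =>
    by_cases h2 : (T.neighborSet v).ncard = 2
    swap
    · exact ⟨v, h2, hv, 0, (hT.connected.threadLength_spec hr v).1, rfl⟩
    obtain ⟨a, b, hab, h⟩ := ncard_neighborSet_eq_two.1 h2
    obtain ⟨c, hc, hcp⟩ : ∃ c, T.Adj v c ∧ T.treeParent r v ≠ c := by
      by_cases hp : T.treeParent r v = a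
      · exact ⟨b, (h b).2 (Or.inr rfl), fun hb => hab (hp.symm.trans hb)⟩
      · exact ⟨a, (h a).2 (Or.inl rfl), hp⟩
    obtain ⟨hcr, hcv⟩ := (hT.treeParent_eq_or r hc).resolve_left fun h => hcp h.2
    have hd := (hT.connected.treeParent_spec hcr).2
    rw [hcv] at hd
    obtain ⟨k, hk, hkr, i, hi, hki⟩ := ih (M - T.dist c r) (by have := hM c; omega) hcr rfl
    refine ⟨k, hk, hkr, i + 1, ?_, by rw [ancestor_succ, hki, hcv]⟩
    refine lt_of_le_of_ne hi fun heq => ?_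
    have := (hT.connected.threadLength_spec hr k).2
    rw [← heq, ancestor_succ, hki, hcv] at this
    exact this h2

theorem IsTree.exists_thread_edge [Finite V] (hT : T.IsTree) (hr : (T.neighborSet r).ncard ≠ 2)
    {a b : V} (h : T.Adj a b) :
    ∃ k, (T.neighborSet k).ncard ≠ 2 ∧ k ≠ r ∧ ∃ i < T.threadLength r k,
      s(a, b) = s(T.ancestor r k i, T.ancestor r k (i + 1)) := by
  rcases hT.treeParent_eq_or r h with ⟨hne, hp⟩ | ⟨hne, hp⟩
  · obtain ⟨k, hk, hkr, i, hi, rfl⟩ := hT.exists_thread hr hne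
    exact ⟨k, hk, hkr, i, hi, by rw [ancestor_succ, hp]⟩
  · obtain ⟨k, hk, hkr, i, hi, rfl⟩ := hT.exists_thread hr hne
    exact ⟨k, hk, hkr, i, hi, by rw [ancestor_succ, hp, Sym2.eq_swap]⟩

/-- An inner vertex of a thread with an edge outside the tree is one of the last two inner vertices,
or one of the first two if the thread does not start at a leaf. -/
theorem IsMaxLeafTree.position_of_adj [Finite V] {G : SimpleGraph V} (hT : G.IsMaxLeafTree T)
    (hr : (T.neighborSet r).ncard ≠ 2) (hk : k ≠ r) {i : ℕ} (h0 : 0 < i)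
    (hi : i < T.threadLength r k) {y : V} (hy : G.Adj (T.ancestor r k i) y)
    (hn : ¬ T.Adj (T.ancestor r k i) y) :
    T.threadLength r k ≤ i + 2 ∨ (i ≤ 2 ∧ k ∉ T.leaves) := by
  have hc := hT.1.2.connected
  have hleaf : ∀ u, 3 ≤ (T.neighborSet u).ncard → u ∉ T.leaves := fun u hu h => by
    have : (T.neighborSet u).ncard = 1 := h
    omega
  have hx : T.ancestor r k i ∉ T.leaves := fun h => by
    have h1 : (T.neighborSet (T.ancestor r k i)).ncard = 1 := h
    have := ncard_neighborSet_ancestor h0 hi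
    omega
  have hinner : ∀ j, 3 ≤ (T.neighborSet (T.ancestor r k j)).ncard →
      0 < j → T.threadLength r k ≤ j := fun j h3 hj => by
    by_contra hlt
    have := ncard_neighborSet_ancestor hj (not_le.1 hlt)
    omega
  obtain ⟨u, hu, h⟩ := hT.exists_branch_near hy hn hx
  rcases hc.adj_ancestor_iff hr hk h0 hi hu with rfl | rfl
  · rcases h with h | ⟨u', hu', hne, h⟩
    · by_cases hi1 : i = 1
      · subst hi1
        exact Or.inr ⟨by omega, hleaf _ h⟩
      · have := hinner _ h (by omega)
        omega
    · by_cases hi1 : i = 1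
      · subst hi1
        refine Or.inr ⟨by omega, fun hl => ?_⟩
        obtain ⟨c, hc'⟩ := mem_leaves_iff.1 hl
        have h1 := (hc' _).1 hu.symm
        have h2 := (hc' _).1 hu'
        exact hne (h2.trans h1.symm)
      · rcases hc.adj_ancestor_iff hr hk (by omega) (by omega) hu' with rfl | rfl
        · by_cases hi2 : i = 2
          · subst hi2
            exact Or.inr ⟨by omega, hleaf _ h⟩
          · have := hinner _ h (by omega)
            omega
        · rw [show i - 1 + 1 = i by omega] at hne
          exact (hne rfl).elim
  · rcases h with h | ⟨u', hu', hne, h⟩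
    · have := hinner _ h (by omega)
      omega
    · by_cases hi1 : i + 1 < T.threadLength r k
      · rcases hc.adj_ancestor_iff hr hk (by omega) hi1 hu' with rfl | rfl
        · exact (hne rfl).elim
        · have := hinner _ h (by omega)
          omega
      · omega

end Thread

/-! ### The monitoring set -/

open Classical in
/-- The vertices chosen on the thread that starts at `k`: its start, its last two inner vertices,
its first two inner vertices unless `k` is a leaf, and the middle of what remains. If the thread
is short, the truncated indices still give vertices of `V`, some of them repeated. -/
noncomputable def landmarks {V : Type*} (T : SimpleGraph V) (r k : V) : Finset V :=
  let w := T.ancestor r k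
  let N := T.threadLength r k
  if k ∈ T.leaves then {w 0, w ((N - 2) / 2), w (N - 2), w (N - 1)}
  else {w 0, w 1, w 2, w (2 + (N - 4) / 2), w (N - 2), w (N - 1)}

open Classical in
/-- The landmarks of all threads. -/
noncomputable def landmarkSet {V : Type*} [Fintype V] (T : SimpleGraph V) (r : V) : Finset V :=
  {k | (T.neighborSet k).ncard ≠ 2}.toFinset.biUnion (T.landmarks r)

theorem landmarks_subset {V : Type*} [Fintype V] {T : SimpleGraph V} (r : V) {k : V}
    (hk : (T.neighborSet k).ncard ≠ 2) : T.landmarks r k ⊆ T.landmarkSet r := by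
  classical
  exact Finset.subset_biUnion_of_mem (T.landmarks r) (by simpa using hk)

theorem mem_landmarkSet_of_ne_two {V : Type*} [Fintype V] {T : SimpleGraph V} (r : V) {k : V}
    (hk : (T.neighborSet k).ncard ≠ 2) : k ∈ T.landmarkSet r := by
  refine landmarks_subset r hk ?_
  rw [landmarks]
  split_ifs <;> simp [ancestor_zero]

theorem Adj.monitors {V : Type*} {G : SimpleGraph V} {a b : V} (hab : G.Adj a b) :
    G.Monitors a b s(a, b) := by
  refine ⟨hab.reachable, fun p hp => ?_⟩
  rw [dist_eq_one_iff_adj.2 hab] at hp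
  cases p with
  | nil => simp at hp
  | cons h' q =>
    cases q with
    | nil => simp
    | cons _ _ => simp at hp

/-- Both ends of an edge of `G` outside the tree are landmarks. -/
theorem IsMaxLeafTree.mem_landmarkSet_of_adj {V : Type*} [Fintype V] {G T : SimpleGraph V}
    (hT : G.IsMaxLeafTree T) {r : V} (hr : (T.neighborSet r).ncard ≠ 2) {x y : V}
    (hxy : G.Adj x y) (hn : ¬ T.Adj x y) : x ∈ T.landmarkSet r := by
  by_cases h2 : (T.neighborSet x).ncard = 2
  swap
  · exact mem_landmarkSet_of_ne_two r h2
  have hxr : x ≠ r := by rintro rfl; exact hr h2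
  obtain ⟨k, hk, hkr, i, hi, rfl⟩ := hT.1.2.exists_thread hr hxr
  refine landmarks_subset r hk ?_
  have h0 : 0 < i := by
    rcases Nat.eq_zero_or_pos i with rfl | h
    · exact (hk h2).elim
    · exact h
  have hpos := hT.position_of_adj hr hkr h0 hi hxy hn
  have hi' : i = T.threadLength r k - 2 ∨ i = T.threadLength r k - 1 ∨
      ((i = 1 ∨ i = 2) ∧ k ∉ T.leaves) := by
    rcases hpos with h | ⟨h, hl⟩
    · omega
    · exact Or.inr (Or.inr ⟨by omega, hl⟩)
  rw [landmarks]
  rcases hi' with h | h | ⟨h | h, hl⟩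
  · rw [← h]; split_ifs <;> simp
  · rw [← h]; split_ifs <;> simp
  · simp [hl, h]
  · simp [hl, h]

/-- An edge with two landmarks as ends is monitored by these. Any other edge is a tree edge in a part
of a thread that lies between two landmarks and is also a thread of `G`, because its inner vertices
have no edges outside the tree; so these two landmarks and the middle one monitor it. -/
theorem IsMaxLeafTree.isMEGSet_landmarkSet {V : Type*} [Fintype V] {G T : SimpleGraph V}
    (hT : G.IsMaxLeafTree T) {r : V} (hr : (T.neighborSet r).ncard ≠ 2) :
    G.IsMEGSet (T.landmarkSet r) := by
  intro e
  induction e using Sym2.ind with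
  | _ a b =>
    intro hab
    replace hab : G.Adj a b := hab
    have hc := hT.1.2.connected
    by_cases hTab : T.Adj a b
    swap
    · exact ⟨a, hT.mem_landmarkSet_of_adj hr hab hTab, b,
        hT.mem_landmarkSet_of_adj hr hab.symm fun h => hTab h.symm, hab.monitors⟩
    obtain ⟨k, hk, hkr, i, hi, he⟩ := hT.1.2.exists_thread_edge hr hTab
    rw [he]
    clear he hTab hab a b
    have hsub := landmarks_subset (T := T) r hk
    have hend : T.ancestor r k (T.threadLength r k) ∈ T.landmarkSet r :=
      mem_landmarkSet_of_ne_two r (hc.threadLength_spec hr k).2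
    have hadj : ∀ j < T.threadLength r k, G.Adj (T.ancestor r k j) (T.ancestor r k (j + 1)) :=
      fun j hj => hT.1.1 (hc.adj_ancestor_succ hr hkr hj)
    have hinj : ∀ j ≤ T.threadLength r k, ∀ l ≤ T.threadLength r k,
        T.ancestor r k j = T.ancestor r k l → j = l :=
      fun j hj l hl h => hc.ancestor_inj hr hkr hj hl h
    have hpos := fun j h0 hj y hy hn =>
      hT.position_of_adj hr hkr (i := j) h0 hj (y := y) hy hn
    have hTadj := fun j h0 hj v hv => hc.adj_ancestor_iff hr hkr (i := j) h0 hj (v := v) hv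
    have htwo := fun j h0 hj => ncard_neighborSet_ancestor (T := T) (r := r) (k := k) (i := j) h0 hj
    have hone := hc.adj_ancestor_succ hr hkr (i := 0) (by omega)
    have hnl : ∀ j, 0 < j → j < T.threadLength r k → T.ancestor r k j ∉ T.leaves :=
      fun j h0 hj h => by
        have h1 : (T.neighborSet (T.ancestor r k j)).ncard = 1 := h
        have := htwo j h0 hj
        omega
    rw [landmarks] at hsub
    have hk0 := ancestor_zero T r k
    generalize T.threadLength r k = N at *
    generalize T.ancestor r k = w at *
    have hboth : w i ∈ T.landmarkSet r → w (i + 1) ∈ T.landmarkSet r →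
        ∃ x ∈ T.landmarkSet r, ∃ y ∈ T.landmarkSet r, G.Monitors x y s(w i, w (i + 1)) :=
      fun h h' => ⟨_, h, _, h', (hadj i hi).monitors⟩
    by_cases hkl : k ∈ T.leaves
    · simp only [hkl, if_true, Finset.insert_subset_iff, Finset.singleton_subset_iff] at hsub
      obtain ⟨m0, mm, m2, m1⟩ := hsub
      have hmem : ∀ j ≤ N, (j = 0 ∨ N ≤ j + 2) → w j ∈ T.landmarkSet r := by
        intro j hj h
        have : j = 0 ∨ j = N - 2 ∨ j = N - 1 ∨ j = N := by omega
        rcases this with rfl | rfl | rfl | rfl <;> assumption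
      by_cases hs : i < N - 2 ∧ 4 ≤ N
      swap
      · exact hboth (hmem _ (by omega) (by omega)) (hmem _ (by omega) (by omega))
      -- An edge from the leaf `w 0` to `w (N - 2)` would force its tree neighbour `w 1` to be a
      -- branch vertex.
      have hends : ¬ G.Adj (w 0) (w (N - 2)) := by
        intro h
        rw [hk0] at h hone
        refine hT.ncard_ne_two_of_adj_leaf h.symm (fun h' => ?_) hkl
          (hnl _ (by omega) (by omega)) hone (htwo 1 (by omega) (by omega))
        rcases hTadj _ (by omega) (by omega) _ h' with h1 | h1
        · have := hinj 0 (by omega) _ (by omega) (hk0.trans h1); omega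
        · have := hinj 0 (by omega) _ (by omega) (hk0.trans h1); omega
      rcases exists_monitors_of_thread (G := G) (w := w) (L := N - 2) (i := i)
        (fun j hj => hadj j (by omega))
        (fun j hj l hl h => hinj j (by omega) l (by omega) h)
        (fun j h0 hj v hv => hTadj j h0 (by omega) v (by
          by_contra hn
          have := hpos j h0 (by omega) v hv hn
          rcases this with h | h
          · omega
          · exact h.2 hkl)) hends hs.1 with h | h
      · exact ⟨_, m0, _, mm, h⟩
      · exact ⟨_, m2, _, mm, h⟩
    · simp only [hkl, if_false, Finset.insert_subset_iff, Finset.singleton_subset_iff] at hsub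
      obtain ⟨m0, m1, m2, mm, m2', m1'⟩ := hsub
      have hmem : ∀ j ≤ N, (j ≤ 2 ∨ N ≤ j + 2) → w j ∈ T.landmarkSet r := by
        intro j hj h
        have : j = 0 ∨ j = 1 ∨ j = 2 ∨ j = N - 2 ∨ j = N - 1 ∨ j = N := by omega
        rcases this with rfl | rfl | rfl | rfl | rfl | rfl <;> assumption
      by_cases hs : 2 ≤ i ∧ i < N - 2 ∧ 6 ≤ N
      swap
      · exact hboth (hmem _ (by omega) (by omega)) (hmem _ (by omega) (by omega))
      -- An edge between the non-leaves `w 2` and `w (N - 2)` would force `w 1` or `w 3` to be a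
      -- branch vertex.
      have hends : ¬ G.Adj (w 2) (w (N - 2)) := by
        intro h
        have hn : ¬ T.Adj (w 2) (w (N - 2)) := fun h' => by
          rcases hTadj _ (by omega) (by omega) _ h' with h1 | h1
          · have := hinj _ (by omega) _ (by omega) h1; omega
          · have := hinj _ (by omega) _ (by omega) h1; omega
        obtain ⟨u, hu, h3⟩ := hT.exists_three_le_of_adj h hn (hnl _ (by omega) (by omega))
          (hnl _ (by omega) (by omega))
        rcases hTadj _ (by omega) (by omega) _ hu with rfl | rfl
        · have := htwo 1 (by omega) (by omega)
          simp only [Nat.add_one_sub_one] at h3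
          omega
        · have := htwo 3 (by omega) (by omega)
          simp only [Nat.reduceAdd] at h3
          omega
      obtain ⟨l, rfl⟩ := Nat.exists_eq_add_of_le hs.1
      have hmid := exists_monitors_of_thread (G := G) (w := fun j => w (2 + j)) (L := N - 4)
        (i := l)
        (fun j hj => hadj (2 + j) (by omega))
        (fun j hj l hl h => by
          have := hinj _ (by omega) _ (by omega) h
          omega)
        (fun j h0 hj v hv => by
          have := hTadj (2 + j) (by omega) (by omega) v (by
            by_contra hn
            have := hpos (2 + j) (by omega) (by omega) v hv hn
            omega)
          rwa [show 2 + j - 1 = 2 + (j - 1) by omega] at this)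
        (by rwa [show 2 + (N - 4) = N - 2 by omega]) (by omega)
      rw [show 2 + (N - 4) = N - 2 by omega] at hmid
      rcases hmid with h | h
      · exact ⟨_, m2, _, mm, h⟩
      · exact ⟨_, m2', _, mm, h⟩

/-- In a tree the sum of `deg v - 2` is `-2`, so that branch vertices are fewer than leaves. -/
theorem IsTree.card_branch_le_card_leaves {V : Type*} [Fintype V] [Nontrivial V]
    {T : SimpleGraph V} (hT : T.IsTree) :
    {v | 3 ≤ (T.neighborSet v).ncard}.ncard ≤ T.leaves.ncard := by
  classical
  have hdeg := T.ncard_neighborSet_eq_degree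
  have hpos : ∀ v, 0 < T.degree v := fun v => hT.connected.preconnected.degree_pos_of_nontrivial v
  have hsum := T.sum_degrees_eq_twice_card_edges
  have hcard := hT.card_edgeFinset
  rw [leaves, Set.ncard_eq_toFinset_card', Set.ncard_eq_toFinset_card']
  simp only [hdeg, Set.toFinset_ofPred, Finset.card_filter]
  have h : ∑ v, (T.degree v + if T.degree v = 1 then 1 else 0) ≥
      ∑ v, (2 + if 3 ≤ T.degree v then 1 else 0) := by
    refine Finset.sum_le_sum fun v _ => ?_
    have := hpos v
    split_ifs <;> omega
  rw [Finset.sum_add_distrib, Finset.sum_add_distrib, hsum, Finset.sum_const, Finset.card_univ,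
    smul_eq_mul] at h
  omega

/-- There are at most four landmarks for each leaf and at most six for each branch vertex. -/
theorem IsTree.card_landmarkSet_le {V : Type*} [Fintype V] [Nontrivial V]
    {T : SimpleGraph V} (hT : T.IsTree) (r : V) :
    (T.landmarkSet r).card ≤ 10 * T.leaves.ncard := by
  classical
  have hB := hT.card_branch_le_card_leaves
  have hdeg := T.ncard_neighborSet_eq_degree
  have hpos : ∀ v, 0 < T.degree v := fun v => hT.connected.preconnected.degree_pos_of_nontrivial v
  have hsplit : T.landmarkSet r ⊆ T.leaves.toFinset.biUnion (T.landmarks r) ∪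
      {v | 3 ≤ (T.neighborSet v).ncard}.toFinset.biUnion (T.landmarks r) := by
    rw [landmarkSet, ← Finset.union_biUnion]
    refine Finset.biUnion_subset_biUnion_of_subset_left _ fun v hv => ?_
    have := hpos v
    rw [Finset.mem_union, Set.mem_toFinset, Set.mem_toFinset]
    have hv' : (T.neighborSet v).ncard ≠ 2 := Set.mem_toFinset.1 hv
    change (T.neighborSet v).ncard = 1 ∨ 3 ≤ (T.neighborSet v).ncard
    rw [hdeg] at hv' ⊢
    omega
  have h4 : (T.leaves.toFinset.biUnion (T.landmarks r)).card ≤ T.leaves.toFinset.card * 4 :=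
    Finset.card_biUnion_le_card_mul _ _ _ fun k hk => by
      rw [landmarks, if_pos (by simpa using hk)]
      exact Finset.card_le_four
  have h6 : ({v | 3 ≤ (T.neighborSet v).ncard}.toFinset.biUnion (T.landmarks r)).card ≤
      {v | 3 ≤ (T.neighborSet v).ncard}.toFinset.card * 6 :=
    Finset.card_biUnion_le_card_mul _ _ _ fun k hk => by
      have hl : k ∉ T.leaves := fun h => by
        have h1 : (T.neighborSet k).ncard = 1 := h
        have h3 : 3 ≤ (T.neighborSet k).ncard := by simpa using hk
        omega
      rw [landmarks, if_neg hl]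
      exact Finset.card_le_six
  rw [← Set.ncard_eq_toFinset_card'] at h4 h6
  have := (Finset.card_le_card hsplit).trans (Finset.card_union_le _ _)
  omega

end SimpleGraph

theorem mainTheorem9 {V : Type*} [Fintype V] (G : SimpleGraph V) (hG : G.Connected) :
    G.megNumber ≤ 10 * G.maxLeafNumber := by
  rcases subsingleton_or_nontrivial V with hV | hV
  · have h : G.megNumber ≤ 0 := by
      refine Nat.sInf_le ⟨∅, fun e => ?_, rfl⟩
      induction e using Sym2.ind with
      | _ a b => exact fun h => ((G.mem_edgeSet.1 h).ne (Subsingleton.elim a b)).elim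
    omega
  obtain ⟨T, hT, hcard⟩ := SimpleGraph.exists_isSpanningTree_ncard_leaves_eq hG
  have hmax : G.IsMaxLeafTree T :=
    ⟨hT, fun T' hT' => hcard ▸ le_csSup G.bddAbove_leaves_ncard ⟨T', hT', rfl⟩⟩
  classical
  obtain ⟨r, hr⟩ := hT.2.exists_vert_degree_one_of_nontrivial
  have hr' : (T.neighborSet r).ncard ≠ 2 := by
    rw [T.ncard_neighborSet_eq_degree, hr]
    omega
  calc G.megNumber ≤ (T.landmarkSet r).card :=
        Nat.sInf_le ⟨_, hmax.isMEGSet_landmarkSet hr', rfl⟩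
    _ ≤ 10 * T.leaves.ncard := hT.2.card_landmarkSet_le r
    _ = 10 * G.maxLeafNumber := by rw [hcard]
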